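/- For $\alpha\in(0,2]$, $\gamma>0$ let $\mathbf S(\alpha,0,\gamma,0)$ be the symmetric stable law on $\mathbb R$, i.e. the probability law with characteristic function $u\mapsto\exp(-\gamma^\alpha|u|^\alpha)$. Fix $\alpha\in[1,2]$ and $\gamma>0$, let $F_S$ be the cumulative distribution function of $S=\mathbf S(\alpha,0,\gamma,0)$ with inverse $F_S^{-1}:(0,1)\to\mathbb R$, and for $K\ge 1$ let $F_{S'}$ be the cumulative distribution function of $S'=\mathbf S(\alpha,0,\gamma',0)$, where $\gamma'=K^{\frac1\alpha-1}\gamma$. Let $p_1,p_2,\dots$ be the p-values of the subtests under the alternative hypothesis: i.i.d. random variables on a probability space $(\Omega,P)$ with a common probability density function $f_1$ on $[0,1]$. The ensemble test with $K$ subtests and significance level $\alpha_e\in(0,1)$ has the statistic $T_e=\frac1K\sum_{k=1}^K F_S^{-1}(p_k)$ and the p-value $p_e=F_{S'}(T_e)$, and rejects the null hypothesis when $p_e\le\alpha_e$; its Type II error and its power are $\beta_e=P(p_e>\alpha_e)$ and $\pi_e=1-\beta_e$. Assume that $F_S^{-1}(p_k)$ is integrable and that 1. $\mathbb E[p_k]\le\alpha_e$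 and $\mathbb E[p_k]<\tfrac12$ (the second inequality follows from the first when $\alpha_e<\tfrac12$); 2. $f_1(p)\ge f_1(1-p)$ for all $p\in[0,\tfrac12]$. Then $\lim_{K\to\infty}\pi_e=1$. -/

import Mathlib

open MeasureTheory ProbabilityTheory Filter Topology

noncomputable section

namespace ECIT

/-- The function `u ↦ E[exp(iuX)]` of the stable distribution `S(α, β, γ, δ)`. -/
def stableCharFun (α β γ δ u : ℝ) : ℂ :=
  if α = 1 then
    Complex.exp (-((γ * |u| : ℝ) : ℂ) *
        (1 + Complex.I * ((β * (2 / Real.pi) * Real.sign u * Real.log |u| : ℝ) : ℂ))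
      + Complex.I * ((δ * u : ℝ) : ℂ))
  else
    Complex.exp (-((γ ^ α * |u| ^ α : ℝ) : ℂ) *
        (1 - Complex.I * ((β * Real.tan (Real.pi * α / 2) * Real.sign u : ℝ) : ℂ))
      + Complex.I * ((δ * u : ℝ) : ℂ))

/-- The measure `μ` is the stable distribution `S(α, β, γ, δ)`. A probability measure on `ℝ` is
determined by its characteristic function, so there is at most one such `μ`. -/
structure IsStableLaw (μ : Measure ℝ) (α β γ δ : ℝ) : Prop where
  alpha_pos : 0 < α
  alpha_le : α ≤ 2
  beta_mem : β ∈ Set.Icc (-1 : ℝ) 1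
  gamma_pos : 0 < γ
  isProbabilityMeasure : IsProbabilityMeasure μ
  charFun_eq : ∀ u : ℝ, charFun μ u = stableCharFun α β γ δ u

/-- The inverse of the cumulative distribution function of `μ`. It is only meaningful at
`q ∈ (0, 1)`. -/
def invCDF (μ : Measure ℝ) (q : ℝ) : ℝ :=
  sInf {x : ℝ | q ≤ cdf μ x}

/-- The statistic `T_e = (1/K) ∑ F_S⁻¹(p_k)` of the ensemble test. -/
def ensembleStat (S : Measure ℝ) {K : ℕ} (p : Fin K → ℝ) : ℝ :=
  (1 / (K : ℝ)) * ∑ k, invCDF S (p k)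

/-- The (lower-tail) ensemble p-value `p_e = F_{S'}(T_e)`. -/
def ensemblePValue (S S' : Measure ℝ) {K : ℕ} (p : Fin K → ℝ) : ℝ :=
  cdf S' (ensembleStat S p)

/-- The scale `γ' = K ^ (1/α - 1) γ`. -/
def ensembleScale (α γ : ℝ) (K : ℕ) : ℝ :=
  (K : ℝ) ^ (1 / α - 1) * γ

variable {Ω : Type*} [MeasurableSpace Ω]

/-- The Type II error `β_e = P(p_e > α_e)` of the ensemble test at level `αe` with `K` subtests,
where `P` is the probability under the alternative and `p 0, p 1, …` are the subtest p-values. -/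
def typeIIError (P : Measure Ω) (S S' : Measure ℝ) (p : ℕ → Ω → ℝ) (αe : ℝ) (K : ℕ) : ℝ :=
  P.real {ω | αe < ensemblePValue S S' (fun k : Fin K => p k ω)}

/-- The power `π_e = 1 - β_e`. -/
def power (P : Measure Ω) (S S' : Measure ℝ) (p : ℕ → Ω → ℝ) (αe : ℝ) (K : ℕ) : ℝ :=
  1 - typeIIError P S S' p αe K

/-- The p-value `X`, a random variable with values in `[0, 1]` up to a null event, has probability
density function `f` on `[0, 1]`. -/
structure HasPValueDensity (P : Measure Ω) (X : Ω → ℝ) (f : ℝ → ℝ) : Prop where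
  measurable : Measurable X
  measurable_density : Measurable f
  nonneg : ∀ t ∈ Set.Icc (0 : ℝ) 1, 0 ≤ f t
  law : P.map X = (volume.restrict (Set.Icc (0 : ℝ) 1)).withDensity fun t => ENNReal.ofReal (f t)

end ECIT

end

/-!
Let `Q = invCDF S`, `F = cdf S`, and let `T_K` be the ensemble statistic. By the strong law of large
numbers `T_K → m = E[Q(p)]`. The proof shows that `m` lies strictly below some point at which the
null distribution functions of `T_K` are eventually at most `αe`; then `P(p_e > αe) → 0`
(`tendsto_power_of_integral_lt`).

Both facts needed about `m` come from one folding argument (`HasPValueDensity.integral_pos`): since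
`f(t) ≥ f(1 - t)` on `[0, 1/2]`, with strict inequality on a set of positive measure because
`E[p] < 1/2`, a function `G` that is positive on `(0, 1/2)` and satisfies `G(t) + G(1 - t) ≥ 0` has
`E[G(p)] > 0`.

* With `G = -Q` it gives `m < 0`. Here `Q(t) < 0` for `t < 1/2` because `S` is symmetric without
  an atom at `0`, the absence of an atom being read off from the decay of the characteristic
  function; and `Q(t) + Q(1 - t) ≤ 0` by symmetry.
* With `G(t) = t - L(Q(t))`, for `α = 1` and `L` the tangent to `F` at `m`, it gives
  `F(m) < E[p] ≤ αe`. Here `F` is the Cauchy distribution function `1/2 + arctan(x/γ)/π`, which is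
  strictly convex on the negative half-line. That `S(1, 0, γ, 0)` is the Cauchy law follows by
  Fourier inversion from the Fourier transform of `exp(-2πγ|v|)`.

The null law of `T_K` is `S` scaled by `K ^ (1/α - 1)`. For `α > 1` the scale tends to `0`, so its
distribution function tends to `0` at every negative point, and `m < 0` suffices. For `α = 1` it is
`S` itself, and `F(m) < αe` together with right continuity of `F` suffices.
-/

namespace ECIT

/-! ### Symmetric stable laws -/

lemma stableCharFun_symm {α : ℝ} (γ u : ℝ) :
    stableCharFun α 0 γ 0 u = Complex.exp (-((γ ^ α * |u| ^ α : ℝ) : ℂ)) := by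
  unfold stableCharFun
  split_ifs with h
  · subst h; simp
  · simp

namespace IsStableLaw

variable {S S' : Measure ℝ} {α γ : ℝ}

lemma charFun_eq_exp (hS : IsStableLaw S α 0 γ 0) (u : ℝ) :
    charFun S u = Complex.exp (-((γ ^ α * |u| ^ α : ℝ) : ℂ)) :=
  (hS.charFun_eq u).trans (stableCharFun_symm γ u)

/-- `S(α, 0, cγ, 0)` is the law of `c X` when `X` has law `S(α, 0, γ, 0)`. -/
lemma eq_map_mul (hS : IsStableLaw S α 0 γ 0) {c : ℝ} (hc : 0 < c)
    (hS' : IsStableLaw S' α 0 (c * γ) 0) : S' = S.map (c * ·) := by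
  have := hS.isProbabilityMeasure
  have := hS'.isProbabilityMeasure
  refine Measure.ext_of_charFun (funext fun u => ?_)
  rw [charFun_map_mul, hS.charFun_eq_exp, hS'.charFun_eq_exp, Real.mul_rpow hc.le hS.gamma_pos.le,
    abs_mul, abs_of_pos hc, Real.mul_rpow hc.le (abs_nonneg u)]
  congr 3
  ring

lemma cdf_eq_cdf_div (hS : IsStableLaw S α 0 γ 0) {c : ℝ} (hc : 0 < c)
    (hS' : IsStableLaw S' α 0 (c * γ) 0) (x : ℝ) : cdf S' x = cdf S (x / c) := by
  have := hS.isProbabilityMeasure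
  have := hS'.isProbabilityMeasure
  rw [cdf_eq_real, cdf_eq_real, hS.eq_map_mul hc hS',
    map_measureReal_apply (by fun_prop) measurableSet_Iic]
  congr 1
  ext y
  simp [le_div_iff₀' hc]

lemma map_neg (hS : IsStableLaw S α 0 γ 0) : S.map (fun x => -x) = S := by
  have := hS.isProbabilityMeasure
  refine Measure.ext_of_charFun (funext fun u => ?_)
  have h := charFun_map_mul (μ := S) (-1) u
  simp only [neg_one_mul] at h
  rw [h, hS.charFun_eq_exp, hS.charFun_eq_exp, abs_neg]

lemma real_Ici_neg (hS : IsStableLaw S α 0 γ 0) (x : ℝ) :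
    S.real (Set.Ici (-x)) = S.real (Set.Iic x) := by
  conv_lhs => rw [← hS.map_neg]
  rw [map_measureReal_apply (by fun_prop) measurableSet_Ici]
  congr 1
  ext y
  simp

/-- The mass of a finite measure at `0` is the limit of the means of its characteristic function
over `[-r, r]`, here `∫ sinc (r x)`; for a stable law the integrand vanishes at infinity. -/
lemma real_singleton_zero (hS : IsStableLaw S α 0 γ 0) : S.real {0} = 0 := by
  have := hS.isProbabilityMeasure
  have h1 : Tendsto (fun r : ℝ => ∫ x, Real.sinc (r * x) ∂S) atTop
      (𝓝 (∫ x, Set.indicator {0} (fun _ => (1 : ℝ)) x ∂S)) := by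
    refine tendsto_integral_filter_of_dominated_convergence (fun _ => 1)
      (Eventually.of_forall fun r => ?_) (Eventually.of_forall fun r => ae_of_all _ fun x => ?_)
      (integrable_const _) (ae_of_all _ fun x => ?_)
    · exact (Real.continuous_sinc.comp (continuous_const.mul continuous_id)).aestronglyMeasurable
    · simpa using Real.abs_sinc_le_one _
    · by_cases hx : x = 0
      · simp [hx]
      · have h0 : Tendsto (fun r : ℝ => |r * x|⁻¹) atTop (𝓝 0) := by
          refine tendsto_inv_atTop_zero.comp ?_
          simp_rw [abs_mul]
          exact tendsto_abs_atTop_atTop.atTop_mul_const (abs_pos.2 hx)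
        simp only [Set.indicator, Set.mem_singleton_iff, hx, if_false]
        refine squeeze_zero_norm' ?_ h0
        filter_upwards [eventually_gt_atTop 0] with r hr
        rw [Real.sinc_of_ne_zero (mul_ne_zero hr.ne' hx), norm_div, Real.norm_eq_abs,
          Real.norm_eq_abs, div_eq_mul_inv]
        exact mul_le_of_le_one_left (by positivity) (Real.abs_sin_le_one _)
  have h2 : Tendsto (fun r : ℝ => ∫ t in (-1 : ℝ)..1, charFun S (r * t)) atTop (𝓝 0) := by
    have : (0 : ℂ) = ∫ t in (-1 : ℝ)..1, (0 : ℂ) := by simp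
    rw [this]
    refine intervalIntegral.tendsto_integral_filter_of_dominated_convergence (fun _ => 1)
      (Eventually.of_forall fun r => ?_)
      (Eventually.of_forall fun r => ae_of_all _ fun x _ => norm_charFun_le_one _)
      (by simp) ?_
    · exact (continuous_charFun.comp (continuous_const.mul continuous_id)).aestronglyMeasurable
    · have h0 : ∀ᵐ t : ℝ, t ≠ 0 := by simp [ae_iff]
      filter_upwards [h0] with t ht _
      simp_rw [hS.charFun_eq_exp, ← Complex.ofReal_neg, ← Complex.ofReal_exp]
      rw [← Complex.ofReal_zero]
      refine (Complex.continuous_ofReal.tendsto 0).comp ?_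
      refine Real.tendsto_exp_atBot.comp (tendsto_neg_atTop_atBot.comp ?_)
      refine Tendsto.const_mul_atTop (Real.rpow_pos_of_pos hS.gamma_pos _) ?_
      refine (tendsto_rpow_atTop hS.alpha_pos).comp ?_
      simp_rw [abs_mul]
      exact tendsto_abs_atTop_atTop.atTop_mul_const (abs_pos.2 ht)
  have h3 : ∀ᶠ r : ℝ in atTop, ∫ t in (-1 : ℝ)..1, charFun S (r * t)
      = ((2 * ∫ x, Real.sinc (r * x) ∂S : ℝ) : ℂ) := by
    filter_upwards [eventually_gt_atTop 0] with r hr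
    rw [intervalIntegral.integral_comp_mul_left (fun t => charFun S t) hr.ne']
    have := integral_charFun_Icc (μ := S) hr
    rw [mul_neg, mul_one, this, Complex.real_smul]
    have : (r : ℂ) ≠ 0 := by exact_mod_cast hr.ne'
    push_cast
    field_simp
  have h4 := tendsto_nhds_unique (h2.congr' h3)
    ((Complex.continuous_ofReal.tendsto _).comp (h1.const_mul 2))
  have h5 : ∫ x, Set.indicator {0} (fun _ => (1 : ℝ)) x ∂S = S.real {0} := by
    rw [integral_indicator (measurableSet_singleton 0)]
    simp [measureReal_def]
  rw [h5] at h4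
  have h6 : 2 * S.real {0} = 0 := by exact_mod_cast h4.symm
  linarith

lemma real_Iio_zero (hS : IsStableLaw S α 0 γ 0) : S.real (Set.Iio 0) = 1 / 2 := by
  have := hS.isProbabilityMeasure
  have h1 : S.real (Set.Iic 0) = S.real (Set.Iio 0) := by
    rw [← Set.Iio_insert, Set.insert_eq, Set.union_comm, measureReal_union (by simp) (by simp),
      hS.real_singleton_zero, add_zero]
  have h2 := hS.real_Ici_neg 0
  have h3 := measureReal_add_measureReal_compl (μ := S) (measurableSet_Iio (a := (0 : ℝ)))
  rw [Set.compl_Iio] at h3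
  rw [neg_zero] at h2
  simp at h3
  linarith

lemma exists_neg_lt_cdf (hS : IsStableLaw S α 0 γ 0) {t : ℝ} (ht : t < 1 / 2) :
    ∃ x < 0, t < cdf S x := by
  have := hS.isProbabilityMeasure
  have h : Tendsto (fun n : ℕ => S (Set.Iic (-1 / ((n : ℝ) + 1)))) atTop (𝓝 (S (Set.Iio 0))) := by
    have hU : Set.Iio (0 : ℝ) = ⋃ n : ℕ, Set.Iic (-1 / ((n : ℝ) + 1)) := by
      ext x
      simp only [Set.mem_Iio, Set.mem_iUnion, Set.mem_Iic]
      constructor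
      · intro hx
        obtain ⟨n, hn⟩ := exists_nat_one_div_lt (neg_pos.2 hx)
        exact ⟨n, by rw [neg_div]; linarith⟩
      · rintro ⟨n, hn⟩
        exact hn.trans_lt (div_neg_of_neg_of_pos (by norm_num) (by positivity))
    rw [hU]
    refine tendsto_measure_iUnion_atTop fun m n hmn => Set.Iic_subset_Iic.2 ?_
    rw [neg_div, neg_div, neg_le_neg_iff]
    exact one_div_le_one_div_of_le (by positivity) (by gcongr)
  have h' := (ENNReal.tendsto_toReal (measure_ne_top S _)).comp h
  change Tendsto _ _ (𝓝 (S.real (Set.Iio 0))) at h'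
  rw [hS.real_Iio_zero] at h'
  obtain ⟨n, hn⟩ := (h'.eventually (lt_mem_nhds ht)).exists
  exact ⟨-1 / ((n : ℝ) + 1), div_neg_of_neg_of_pos (by norm_num) (by positivity),
    by rw [cdf_eq_real]; exact hn⟩

end IsStableLaw

/-! ### Quantiles -/

section Quantile

variable (S : Measure ℝ)

lemma nonempty_setOf_le_cdf {t : ℝ} (ht : t < 1) : {x : ℝ | t ≤ cdf S x}.Nonempty :=
  ((tendsto_cdf_atTop S).eventually (lt_mem_nhds ht)).exists.imp fun _ h => h.le

lemma bddBelow_setOf_le_cdf {t : ℝ} (ht : 0 < t) : BddBelow {x : ℝ | t ≤ cdf S x} := by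
  obtain ⟨y, hy⟩ := ((tendsto_cdf_atBot S).eventually (gt_mem_nhds ht)).exists
  exact ⟨y, fun x hx => le_of_lt ((monotone_cdf S).reflect_lt (hy.trans_le hx))⟩

variable {S}

lemma invCDF_le {t x : ℝ} (ht : 0 < t) (hx : t ≤ cdf S x) : invCDF S t ≤ x :=
  csInf_le (bddBelow_setOf_le_cdf S ht) hx

lemma cdf_lt_of_lt_invCDF {t x : ℝ} (ht : 0 < t) (hx : x < invCDF S t) : cdf S x < t :=
  lt_of_not_ge fun h => (invCDF_le ht h).not_gt hx

variable (S) in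
lemma monotoneOn_invCDF : MonotoneOn (invCDF S) (Set.Ioo 0 1) := fun _ hs _ ht hst =>
  csInf_le_csInf (bddBelow_setOf_le_cdf S hs.1) (nonempty_setOf_le_cdf S ht.2)
    fun _ hx => hst.trans hx

variable (S) in
lemma measurable_invCDF : Measurable (invCDF S) := by
  refine measurable_of_restrict_of_restrict_compl (measurableSet_Ioo (a := (0 : ℝ)) (b := 1)) ?_ ?_
  · have : Monotone ((Set.Ioo (0 : ℝ) 1).domRestrict (invCDF S)) := fun x y hxy =>
      monotoneOn_invCDF S x.2 y.2 hxy
    exact this.measurable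
  · -- outside `(0, 1)` only the value at `1` can differ from the junk value `0` of `sInf`
    have h : (Set.Ioo (0 : ℝ) 1)ᶜ.domRestrict (invCDF S)
        = (Set.Ioo (0 : ℝ) 1)ᶜ.domRestrict (Set.indicator {1} (invCDF S)) := by
      ext ⟨q, hq⟩
      simp only [Set.domRestrict_apply, Set.indicator, Set.mem_singleton_iff]
      split_ifs with h1
      · rfl
      · rw [invCDF]
        rcases le_or_gt q 0 with h0 | h0
        · have : {x : ℝ | q ≤ cdf S x} = Set.univ :=
            Set.eq_univ_of_forall fun x => h0.trans (cdf_nonneg S x)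
          simp [this]
        · have hq1 : 1 < q := lt_of_le_of_ne (not_lt.1 fun h => hq ⟨h0, h⟩) (Ne.symm h1)
          have : {x : ℝ | q ≤ cdf S x} = ∅ :=
            Set.eq_empty_of_forall_notMem fun x hx => (hq1.trans_le hx).not_ge (cdf_le_one S x)
          simp [this]
    rw [h]
    refine Measurable.comp ?_ measurable_subtype_coe
    have : Set.indicator {1} (invCDF S) = Set.indicator {1} fun _ => invCDF S 1 :=
      Set.indicator_congr fun x hx => by rw [Set.mem_singleton_iff.1 hx]
    rw [this]
    exact measurable_const.indicator (measurableSet_singleton 1)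

variable {α γ : ℝ}

lemma IsStableLaw.invCDF_neg (hS : IsStableLaw S α 0 γ 0) {t : ℝ}
    (ht : t ∈ Set.Ioo (0 : ℝ) (1 / 2)) : invCDF S t < 0 := by
  obtain ⟨x, hx, h⟩ := hS.exists_neg_lt_cdf ht.2
  exact (invCDF_le ht.1 h.le).trans_lt hx

/-- `invCDF` is the left quantile function; the reflection of the left quantile at `t` is the right
quantile at `1 - t`, which is at least the left one. -/
lemma IsStableLaw.invCDF_one_sub_le (hS : IsStableLaw S α 0 γ 0) {t : ℝ}
    (ht : t ∈ Set.Ioo (0 : ℝ) 1) : invCDF S (1 - t) ≤ -invCDF S t := by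
  have := hS.isProbabilityMeasure
  refine le_of_forall_lt fun y hy => ?_
  obtain ⟨z, hyz, hz⟩ := exists_between hy
  have h1 : cdf S z < 1 - t := cdf_lt_of_lt_invCDF (by linarith [ht.2]) hz
  have h2 : t ≤ cdf S (-z) := by
    rw [cdf_eq_real] at h1 ⊢
    rw [← hS.real_Ici_neg, neg_neg]
    have h3 := measureReal_add_measureReal_compl (μ := S) (measurableSet_Iic (a := z))
    rw [Set.compl_Iic] at h3
    have h4 : S.real (Set.Ioi z) ≤ S.real (Set.Ici z) := measureReal_mono Set.Ioi_subset_Ici_self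
    simp at h3
    linarith
  linarith [invCDF_le ht.1 h2]

end Quantile

/-! ### Comparison of a density on `[0, 1]` with its reflection -/

lemma setIntegral_Icc_eq_fold {h : ℝ → ℝ} (hh : IntegrableOn h (Set.Icc 0 1)) :
    IntegrableOn (fun t => h t + h (1 - t)) (Set.Ioo 0 (1 / 2)) ∧
    ∫ t in Set.Icc (0 : ℝ) 1, h t = ∫ t in Set.Ioo (0 : ℝ) (1 / 2), (h t + h (1 - t)) := by
  have hi : IntervalIntegrable h volume 0 1 :=
    (intervalIntegrable_iff_integrableOn_Icc_of_le zero_le_one).2 hh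
  have h1 : IntervalIntegrable h volume 0 (1 / 2) :=
    hi.mono_set (by rw [Set.uIcc_of_le, Set.uIcc_of_le] <;> norm_num; exact
      Set.Icc_subset_Icc_right (by norm_num))
  have h2 : IntervalIntegrable h volume (1 / 2) 1 :=
    hi.mono_set (by rw [Set.uIcc_of_le, Set.uIcc_of_le] <;> norm_num; exact
      Set.Icc_subset_Icc_left (by norm_num))
  have h3 : IntervalIntegrable (fun t => h (1 - t)) volume 0 (1 / 2) := by
    have := (h2.comp_sub_left 1).symm
    norm_num at this ⊢
    exact this
  have h4 : ∫ t in (1 / 2 : ℝ)..1, h t = ∫ t in (0 : ℝ)..(1 / 2), h (1 - t) := by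
    rw [intervalIntegral.integral_comp_sub_left]
    norm_num
  constructor
  · exact (intervalIntegrable_iff_integrableOn_Ioo_of_le (by norm_num)).1 (h1.add h3)
  · rw [integral_Icc_eq_integral_Ioc, ← intervalIntegral.integral_of_le zero_le_one,
      ← intervalIntegral.integral_add_adjacent_intervals h1 h2, h4,
      ← intervalIntegral.integral_add h1 h3, intervalIntegral.integral_of_le (by norm_num),
      integral_Ioc_eq_integral_Ioo]

section Density

variable {Ω : Type*} [MeasurableSpace Ω] {P : Measure Ω} {X : Ω → ℝ} {f G : ℝ → ℝ}

namespace HasPValueDensity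

lemma integral_comp (hX : HasPValueDensity P X f) (hG : Measurable G) :
    ∫ ω, G (X ω) ∂P = ∫ t in Set.Icc (0 : ℝ) 1, f t * G t := by
  rw [← integral_map (f := G) hX.measurable.aemeasurable hG.aestronglyMeasurable, hX.law,
    integral_withDensity_eq_integral_toReal_smul (by have := hX.measurable_density; fun_prop)
      (ae_of_all _ fun _ => ENNReal.ofReal_lt_top)]
  refine setIntegral_congr_fun measurableSet_Icc fun t ht => ?_
  simp [ENNReal.toReal_ofReal (hX.nonneg t ht)]

lemma integrable_comp_iff (hX : HasPValueDensity P X f) (hG : Measurable G) :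
    Integrable (fun ω => G (X ω)) P ↔ IntegrableOn (fun t => f t * G t) (Set.Icc 0 1) := by
  have h1 := integrable_map_measure (μ := P) (f := X) (g := G) hG.aestronglyMeasurable
    hX.measurable.aemeasurable
  rw [show (fun ω => G (X ω)) = G ∘ X from rfl, ← h1, hX.law,
    integrable_withDensity_iff_integrable_smul' (by have := hX.measurable_density; fun_prop)
      (ae_of_all _ fun _ => ENNReal.ofReal_lt_top)]
  refine integrableOn_congr_fun (fun t ht => ?_) measurableSet_Icc
  simp [ENNReal.toReal_ofReal (hX.nonneg t ht)]

lemma ae_mem_Icc (hX : HasPValueDensity P X f) : ∀ᵐ ω ∂P, X ω ∈ Set.Icc (0 : ℝ) 1 := by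
  refine ae_of_ae_map hX.measurable.aemeasurable ?_
  rw [hX.law]
  exact (withDensity_absolutelyContinuous _ _).ae_le (ae_restrict_mem measurableSet_Icc)

lemma integrable [IsFiniteMeasure P] (hX : HasPValueDensity P X f) : Integrable X P := by
  refine Integrable.of_bound hX.measurable.aestronglyMeasurable 1 ?_
  filter_upwards [hX.ae_mem_Icc] with ω hω
  rw [Real.norm_eq_abs, abs_of_nonneg hω.1]
  exact hω.2

variable [IsProbabilityMeasure P]

lemma not_ae_eq_reflection (hX : HasPValueDensity P X f) (hmean : ∫ ω, X ω ∂P < 1 / 2) :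
    ¬ ∀ᵐ t ∂volume.restrict (Set.Ioo (0 : ℝ) (1 / 2)), f t = f (1 - t) := by
  intro h
  have hm : Measurable fun t : ℝ => 1 / 2 - t := by fun_prop
  have hi : Integrable (fun ω => 1 / 2 - X ω) P := (integrable_const _).sub hX.integrable
  have h0 : ∫ ω, (1 / 2 - X ω) ∂P = 0 := by
    rw [hX.integral_comp hm, (setIntegral_Icc_eq_fold ((hX.integrable_comp_iff hm).1 hi)).2]
    refine integral_eq_zero_of_ae ?_
    filter_upwards [h] with t ht
    rw [← ht, Pi.zero_apply]
    ring
  rw [integral_sub (integrable_const _) hX.integrable] at h0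
  simp at h0
  linarith

/-- If the density puts more mass at each point of `(0, 1/2)` than at its mirror image, then
`G` has positive mean as soon as `G` is positive on `(0, 1/2)` and its symmetric part is
nonnegative: folding at `1/2`, the integrand is at least `G t * (f t - f (1 - t))`. -/
lemma integral_pos (hX : HasPValueDensity P X f) (hmean : ∫ ω, X ω ∂P < 1 / 2)
    (hsymm : ∀ t ∈ Set.Icc (0 : ℝ) (1 / 2), f (1 - t) ≤ f t) (hG : Measurable G)
    (hGint : Integrable (fun ω => G (X ω)) P)
    (hpos : ∀ᵐ t ∂volume.restrict (Set.Ioo (0 : ℝ) (1 / 2)), 0 < G t)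
    (hrefl : ∀ t ∈ Set.Ioo (0 : ℝ) (1 / 2), 0 ≤ G t + G (1 - t)) :
    0 < ∫ ω, G (X ω) ∂P := by
  obtain ⟨hi, he⟩ := setIntegral_Icc_eq_fold ((hX.integrable_comp_iff hG).1 hGint)
  rw [hX.integral_comp hG, he]
  have key : ∀ᵐ t ∂volume.restrict (Set.Ioo (0 : ℝ) (1 / 2)),
      0 < G t ∧ 0 ≤ f t - f (1 - t) ∧
      G t * (f t - f (1 - t)) ≤ f t * G t + f (1 - t) * G (1 - t) := by
    filter_upwards [hpos, ae_restrict_mem measurableSet_Ioo] with t ht htm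
    refine ⟨ht, sub_nonneg.2 (hsymm t ⟨htm.1.le, htm.2.le⟩), ?_⟩
    have h0 : 0 ≤ f (1 - t) := hX.nonneg _ ⟨by linarith [htm.2], by linarith [htm.1]⟩
    nlinarith [mul_nonneg h0 (hrefl t htm)]
  have hnn : 0 ≤ᵐ[volume.restrict (Set.Ioo (0 : ℝ) (1 / 2))]
      fun t => f t * G t + f (1 - t) * G (1 - t) := by
    filter_upwards [key] with t ⟨h1, h2, h3⟩
    exact (mul_nonneg h1.le h2).trans h3
  refine lt_of_le_of_ne (integral_nonneg_of_ae hnn) fun h => ?_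
  refine hX.not_ae_eq_reflection hmean ?_
  filter_upwards [key, (integral_eq_zero_iff_of_nonneg_ae hnn hi).1 h.symm] with t ⟨h1, h2, h3⟩ h4
  rw [h4, Pi.zero_apply] at h3
  have := nonpos_of_mul_nonpos_right h3 h1
  linarith

end HasPValueDensity

end Density

/-! ### The Cauchy law -/

section Cauchy

open scoped NNReal FourierTransform

lemma integrable_exp_neg_abs {a : ℝ} (ha : 0 < a) :
    Integrable fun v : ℝ => Complex.exp (-((a * |v| : ℝ) : ℂ)) := by
  rw [← integrableOn_univ, ← Set.Iic_union_Ioi (a := (0 : ℝ))]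
  refine IntegrableOn.union ?_ ?_
  · refine (integrableOn_exp_mul_complex_Iic (a := a) (by simpa) 0).congr_fun (fun v hv => ?_)
      measurableSet_Iic
    simp [abs_of_nonpos (Set.mem_Iic.1 hv)]
  · refine (integrableOn_exp_mul_complex_Ioi (a := -a) (by simpa) 0).congr_fun (fun v hv => ?_)
      measurableSet_Ioi
    simp [abs_of_pos (Set.mem_Ioi.1 hv)]

lemma fourier_exp_neg_abs {γ : ℝ≥0} (hγ : γ ≠ 0) (w : ℝ) :
    𝓕 (fun v : ℝ => Complex.exp (-((2 * Real.pi * γ * |v| : ℝ) : ℂ))) w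
      = (cauchyPDFReal 0 γ w : ℂ) := by
  have hγ' : (0 : ℝ) < γ := by positivity
  set a : ℂ := 2 * Real.pi * γ - 2 * Real.pi * w * Complex.I with ha
  set b : ℂ := -(2 * Real.pi * γ) - 2 * Real.pi * w * Complex.I with hb
  have har : 0 < a.re := by simp [ha]; positivity
  have hbr : b.re < 0 := by simp [hb]; positivity
  have hneg : Set.EqOn (fun v : ℝ => Complex.exp (a * v)) (fun v : ℝ =>
      Complex.exp (((-2 * Real.pi * inner ℝ v w : ℝ) : ℂ) * Complex.I) •
        Complex.exp (-((2 * Real.pi * γ * |v| : ℝ) : ℂ))) (Set.Iic 0) := by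
    intro v hv
    simp only [smul_eq_mul, ← Complex.exp_add, abs_of_nonpos (Set.mem_Iic.1 hv), ha]
    congr 1
    simp
    ring
  have hpos : Set.EqOn (fun v : ℝ => Complex.exp (b * v)) (fun v : ℝ =>
      Complex.exp (((-2 * Real.pi * inner ℝ v w : ℝ) : ℂ) * Complex.I) •
        Complex.exp (-((2 * Real.pi * γ * |v| : ℝ) : ℂ))) (Set.Ioi 0) := by
    intro v hv
    simp only [smul_eq_mul, ← Complex.exp_add, abs_of_pos (Set.mem_Ioi.1 hv), hb]
    congr 1
    simp
    ring
  have hi1 := (integrableOn_exp_mul_complex_Iic har 0).congr_fun hneg measurableSet_Iic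
  have hi2 := (integrableOn_exp_mul_complex_Ioi hbr 0).congr_fun hpos measurableSet_Ioi
  rw [Real.fourier_eq', ← intervalIntegral.integral_Iic_add_Ioi hi1 hi2,
    ← setIntegral_congr_fun measurableSet_Iic hneg, ← setIntegral_congr_fun measurableSet_Ioi hpos,
    integral_exp_mul_complex_Iic har, integral_exp_mul_complex_Ioi hbr]
  have ha0 : a ≠ 0 := fun h => by simp [h] at har
  have hb0 : b ≠ 0 := fun h => by simp [h] at hbr
  have hab : a * b = -((4 * Real.pi ^ 2 * (w ^ 2 + γ ^ 2) : ℝ) : ℂ) := by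
    simp only [ha, hb]
    push_cast
    linear_combination (4 * Real.pi ^ 2 * w ^ 2 : ℂ) * Complex.I_sq
  have hc : ((4 * Real.pi ^ 2 * (w ^ 2 + γ ^ 2) : ℝ) : ℂ) ≠ 0 := by
    have : 0 < 4 * Real.pi ^ 2 * (w ^ 2 + (γ : ℝ) ^ 2) := by positivity
    exact_mod_cast this.ne'
  have hsum : (b - a) = -(4 * Real.pi * γ : ℂ) := by rw [ha, hb]; ring
  have hlhs : Complex.exp (a * (0 : ℝ)) / a + -Complex.exp (b * (0 : ℝ)) / b
      = (b - a) / (a * b) := by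
    simp
    field_simp
    ring
  rw [hlhs, hab, hsum, neg_div_neg_eq, cauchyPDFReal_def, div_eq_iff hc]
  have hd : (0 : ℝ) < w ^ 2 + (γ : ℝ) ^ 2 := by positivity
  rw [← Complex.ofReal_mul, sub_zero]
  have : Real.pi⁻¹ * γ * (w ^ 2 + (γ : ℝ) ^ 2)⁻¹ * (4 * Real.pi ^ 2 * (w ^ 2 + γ ^ 2))
      = 4 * Real.pi * γ := by field_simp
  rw [this]
  push_cast
  rfl

lemma charFun_cauchyMeasure {γ : ℝ≥0} (hγ : γ ≠ 0) (t : ℝ) :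
    charFun (cauchyMeasure 0 γ) t = Complex.exp (-((γ * |t| : ℝ) : ℂ)) := by
  set f : ℝ → ℂ := fun v => Complex.exp (-((2 * Real.pi * γ * |v| : ℝ) : ℂ)) with hf
  have hF : 𝓕 f = fun w => (cauchyPDFReal 0 γ w : ℂ) := funext (fourier_exp_neg_abs hγ)
  have hinv : 𝓕⁻ (𝓕 f) = f := by
    refine Continuous.fourierInv_fourier_eq (by fun_prop) ?_ ?_
    · exact integrable_exp_neg_abs (by positivity)
    · rw [hF]
      exact (integrable_cauchyPDFReal 0).ofReal
  have h := congrFun hinv (t / (2 * Real.pi))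
  rw [hF, Real.fourierInv_eq', hf] at h
  rw [charFun_apply_real, cauchyMeasure_of_scale_ne_zero 0 hγ,
    integral_withDensity_eq_integral_toReal_smul (by fun_prop) (by simp [cauchyPDF])]
  refine Eq.trans ?_ (h.trans ?_)
  · congr 1
    ext w
    rw [cauchyPDF, ENNReal.toReal_ofReal (cauchyPDF_pos 0 hγ w).le, Complex.real_smul, smul_eq_mul,
      mul_comm]
    congr 2
    simp
    field_simp
  · simp only [abs_div, abs_of_pos Real.two_pi_pos]
    congr 3
    field_simp

lemma hasDerivAt_arctan_div (γ : ℝ≥0) (y : ℝ) :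
    HasDerivAt (fun y : ℝ => 1 / 2 + Real.pi⁻¹ * Real.arctan (y / γ)) (cauchyPDFReal 0 γ y) y := by
  refine ((((hasDerivAt_id' y).div_const (γ : ℝ)).arctan.const_mul Real.pi⁻¹).const_add
    (1 / 2)).congr_deriv ?_
  rw [cauchyPDFReal_def', sub_zero, NNReal.coe_inv]
  ring

lemma cdf_cauchyMeasure {γ : ℝ≥0} (hγ : γ ≠ 0) (x : ℝ) :
    cdf (cauchyMeasure 0 γ) x = 1 / 2 + Real.pi⁻¹ * Real.arctan (x / γ) := by
  have hγ' : (0 : ℝ) < γ := by positivity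
  have h1 : cdf (cauchyMeasure 0 γ) x = ∫ y in Set.Iic x, cauchyPDFReal 0 γ y := by
    rw [cdf_eq_real, cauchyMeasure_of_scale_ne_zero 0 hγ, measureReal_def,
      withDensity_apply _ measurableSet_Iic,
      integral_eq_lintegral_of_nonneg_ae (ae_of_all _ fun y => (cauchyPDF_pos 0 hγ y).le)
        (by fun_prop)]
    rfl
  rw [h1]
  have h2 := integral_Iic_of_hasDerivAt_of_tendsto' (a := x) (m := 0)
    (f := fun y => 1 / 2 + Real.pi⁻¹ * Real.arctan (y / γ)) (f' := cauchyPDFReal 0 γ)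
    (fun y _ => hasDerivAt_arctan_div γ y) (integrable_cauchyPDFReal 0).integrableOn ?_
  · simpa using h2
  · have h0 : Tendsto (fun y : ℝ => Real.arctan (y / γ)) atBot (𝓝 (-(Real.pi / 2))) :=
      (Real.tendsto_arctan_atBot.mono_right nhdsWithin_le_nhds).comp
        (tendsto_id.atBot_div_const hγ')
    have h3 := (h0.const_mul Real.pi⁻¹).const_add (1 / 2)
    convert h3 using 2
    field_simp
    ring

lemma IsStableLaw.eq_cauchyMeasure {S : Measure ℝ} {γ : ℝ≥0} (hS : IsStableLaw S 1 0 γ 0) :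
    S = cauchyMeasure 0 γ := by
  have := hS.isProbabilityMeasure
  refine Measure.ext_of_charFun (funext fun u => ?_)
  rw [hS.charFun_eq_exp, charFun_cauchyMeasure (by exact_mod_cast hS.gamma_pos.ne')]
  simp

lemma strictMono_cdf_cauchyMeasure {γ : ℝ≥0} (hγ : γ ≠ 0) :
    StrictMono (cdf (cauchyMeasure 0 γ)) := by
  intro x y hxy
  have hγ' : (0 : ℝ) < γ := by positivity
  rw [cdf_cauchyMeasure hγ, cdf_cauchyMeasure hγ]
  have : Real.arctan (x / γ) < Real.arctan (y / γ) := Real.arctan_strictMono (by gcongr)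
  have := Real.pi_pos
  gcongr

lemma cdf_invCDF_cauchyMeasure {γ : ℝ≥0} (hγ : γ ≠ 0) {t : ℝ} (ht : t ∈ Set.Ioo (0 : ℝ) 1) :
    cdf (cauchyMeasure 0 γ) (invCDF (cauchyMeasure 0 γ) t) = t := by
  have hγ' : (0 : ℝ) < γ := by positivity
  set x : ℝ := γ * Real.tan (Real.pi * (t - 1 / 2)) with hx
  have hF : cdf (cauchyMeasure 0 γ) x = t := by
    rw [cdf_cauchyMeasure hγ, hx, mul_div_cancel_left₀ _ hγ'.ne', Real.arctan_tan]
    · field_simp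
      ring
    · nlinarith [Real.pi_pos, ht.1]
    · nlinarith [Real.pi_pos, ht.2]
  have hset : {y : ℝ | t ≤ cdf (cauchyMeasure 0 γ) y} = Set.Ici x := by
    ext y
    rw [Set.mem_Ici, ← (strictMono_cdf_cauchyMeasure hγ).le_iff_le (a := x), hF]
    rfl
  rw [invCDF, hset, csInf_Ici, hF]

/-- The Cauchy distribution function is strictly convex on the negative half-line, so there it lies
strictly above each of its tangents. -/
lemma exists_tangent_lt_cdf_cauchyMeasure {γ : ℝ≥0} (hγ : γ ≠ 0) {m : ℝ} (hm : m < 0) :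
    ∃ c : ℝ, 0 ≤ c ∧ ∀ x ≤ 0, x ≠ m →
      cdf (cauchyMeasure 0 γ) m + c * (x - m) < cdf (cauchyMeasure 0 γ) x := by
  have hγ' : (0 : ℝ) < γ := by positivity
  have hd : ∀ y, HasDerivAt (cdf (cauchyMeasure 0 γ)) (cauchyPDFReal 0 γ y) y := by
    intro y
    rw [show (cdf (cauchyMeasure 0 γ) : ℝ → ℝ) = fun y => 1 / 2 + Real.pi⁻¹ * Real.arctan (y / γ)
      from funext (cdf_cauchyMeasure hγ)]
    exact hasDerivAt_arctan_div γ y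
  have hconv : StrictConvexOn ℝ (Set.Iic 0) (cdf (cauchyMeasure 0 γ)) := by
    refine StrictMonoOn.strictConvexOn_of_deriv (convex_Iic 0)
      (fun y _ => (hd y).continuousAt.continuousWithinAt) fun y hy z hz hyz => ?_
    rw [interior_Iic, Set.mem_Iio] at hy hz
    rw [(hd y).deriv, (hd z).deriv, cauchyPDFReal_def, cauchyPDFReal_def]
    have : (z - 0) ^ 2 < (y - 0) ^ 2 := by nlinarith
    have := Real.pi_pos
    gcongr
  refine ⟨cauchyPDFReal 0 γ m, (cauchyPDF_pos 0 hγ m).le, fun x hx hxm => ?_⟩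
  rcases lt_or_gt_of_ne hxm with h | h
  · have := hconv.slope_lt_of_hasDerivAt hx hm.le h (hd m)
    rw [slope_def_field, div_lt_iff₀ (by linarith)] at this
    linarith
  · have := hconv.lt_slope_of_hasDerivAt hm.le hx h (hd m)
    rw [slope_def_field, lt_div_iff₀ (by linarith)] at this
    linarith

end Cauchy

/-! ### The mean of the transformed p-value -/

section Mean

variable {Ω : Type*} [MeasurableSpace Ω] {P : Measure Ω} [IsProbabilityMeasure P]
  {S : Measure ℝ} {α γ : ℝ} {X : Ω → ℝ} {f : ℝ → ℝ}

lemma integral_invCDF_neg (hS : IsStableLaw S α 0 γ 0) (hX : HasPValueDensity P X f)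
    (hmean : ∫ ω, X ω ∂P < 1 / 2) (hsymm : ∀ t ∈ Set.Icc (0 : ℝ) (1 / 2), f (1 - t) ≤ f t)
    (hint : Integrable (fun ω => invCDF S (X ω)) P) :
    ∫ ω, invCDF S (X ω) ∂P < 0 := by
  have h := hX.integral_pos hmean hsymm (measurable_invCDF S).neg hint.neg ?_ ?_
  · simp only [Pi.neg_apply] at h
    rw [integral_neg] at h
    linarith
  · filter_upwards [ae_restrict_mem measurableSet_Ioo] with t ht
    exact neg_pos.2 (hS.invCDF_neg ht)
  · intro t ht
    have := hS.invCDF_one_sub_le (t := t) ⟨ht.1, by linarith [ht.2]⟩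
    simp only [Pi.neg_apply]
    linarith

/-- A strict Jensen inequality for the Cauchy distribution function `F`, which is convex only on
the negative half-line: with `L` the tangent to `F` at the mean of `F⁻¹(X)`, the function
`t ↦ t - L (F⁻¹ t)` is positive for almost every `t < 1/2`, and its symmetric part is at least
`1/2 - L 0`. -/
lemma cdf_integral_invCDF_lt (hS : IsStableLaw S 1 0 γ 0) (hX : HasPValueDensity P X f)
    (hmean : ∫ ω, X ω ∂P < 1 / 2) (hsymm : ∀ t ∈ Set.Icc (0 : ℝ) (1 / 2), f (1 - t) ≤ f t)
    (hint : Integrable (fun ω => invCDF S (X ω)) P) :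
    cdf S (∫ ω, invCDF S (X ω) ∂P) < ∫ ω, X ω ∂P := by
  have hm := integral_invCDF_neg hS hX hmean hsymm hint
  set m := ∫ ω, invCDF S (X ω) ∂P with hm_def
  lift γ to NNReal using hS.gamma_pos.le
  have hγ : γ ≠ 0 := by exact_mod_cast hS.gamma_pos.ne'
  have hSc := hS.eq_cauchyMeasure
  obtain ⟨c, hc, htan⟩ := exists_tangent_lt_cdf_cauchyMeasure hγ hm
  rw [← hSc] at htan
  have hinv : ∀ t ∈ Set.Ioo (0 : ℝ) 1, cdf S (invCDF S t) = t := by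
    rw [hSc]
    exact fun t ht => cdf_invCDF_cauchyMeasure hγ ht
  have hzero : cdf S 0 = 1 / 2 := by
    rw [hSc, cdf_cauchyMeasure hγ]
    simp
  have hi' : Integrable (fun ω => c * (invCDF S (X ω) - m)) P :=
    (hint.sub (integrable_const _)).const_mul c
  have hi : Integrable (fun ω => cdf S m + c * (invCDF S (X ω) - m)) P :=
    (integrable_const _).add hi'
  have h := hX.integral_pos (G := fun t => t - (cdf S m + c * (invCDF S t - m))) hmean hsymm
    (by have := measurable_invCDF S; fun_prop) (hX.integrable.sub hi) ?_ ?_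
  · rw [integral_sub hX.integrable hi, integral_add (integrable_const _) hi',
      integral_const_mul, integral_sub hint (integrable_const _), ← hm_def] at h
    simpa using h
  · have h0 : ∀ᵐ t ∂volume.restrict (Set.Ioo (0 : ℝ) (1 / 2)), t ≠ cdf S m :=
      ae_restrict_of_ae (by simp [ae_iff])
    filter_upwards [h0, ae_restrict_mem measurableSet_Ioo] with t htm ht
    have h1 := hinv t ⟨ht.1, by linarith [ht.2]⟩
    have h2 := htan (invCDF S t) (hS.invCDF_neg ht).le fun h => htm (by rw [← h, h1])
    rw [h1] at h2
    linarith
  · intro t ht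
    have h1 := hS.invCDF_one_sub_le (t := t) ⟨ht.1, by linarith [ht.2]⟩
    have h2 := htan 0 le_rfl hm.ne'
    rw [hzero] at h2
    nlinarith

end Mean

/-! ### Consistency -/

section Consistency

variable {Ω : Type*} [MeasurableSpace Ω] {P : Measure Ω} [IsProbabilityMeasure P]
  {p : ℕ → Ω → ℝ} {f : ℝ → ℝ}

lemma tendstoInMeasure_ensembleStat {S : Measure ℝ} (hindep : iIndepFun p P)
    (hp : ∀ k, HasPValueDensity P (p k) f)
    (hint : ∀ k, Integrable (fun ω => invCDF S (p k ω)) P) :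
    TendstoInMeasure P (fun (K : ℕ) ω => ensembleStat S (fun k : Fin K => p k ω)) atTop
      (fun _ => ∫ ω, invCDF S (p 0 ω) ∂P) := by
  have hQ := measurable_invCDF S
  have hmeas : ∀ k, Measurable fun ω => invCDF S (p k ω) := fun k => hQ.comp (hp k).measurable
  have hident : ∀ k, IdentDistrib (fun ω => invCDF S (p k ω)) (fun ω => invCDF S (p 0 ω)) P P :=
    fun k => (IdentDistrib.mk (hp k).measurable.aemeasurable (hp 0).measurable.aemeasurable
      ((hp k).law.trans (hp 0).law.symm)).comp hQ
  have hlln := strong_law_ae_real (fun k ω => invCDF S (p k ω)) (hint 0)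
    (fun i j hij => (hindep.indepFun hij).comp hQ hQ) hident
  refine tendstoInMeasure_of_tendsto_ae (fun K => ?_) ?_
  · exact ((Finset.univ.measurable_sum fun (k : Fin K) _ =>
      hmeas k).const_mul _).aestronglyMeasurable
  · filter_upwards [hlln] with ω hω
    refine hω.congr fun K => ?_
    rw [ensembleStat, Fin.sum_univ_eq_sum_range (fun k => invCDF S (p k ω)) K]
    ring

/-- If the statistic has mean below a point at which the null distribution functions are eventually
at most `αe`, then the power tends to `1`. -/
lemma tendsto_power_of_integral_lt {S : Measure ℝ} {S' : ℕ → Measure ℝ} (hindep : iIndepFun p P)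
    (hp : ∀ k, HasPValueDensity P (p k) f)
    (hint : ∀ k, Integrable (fun ω => invCDF S (p k ω)) P) {αe x : ℝ}
    (hx : ∫ ω, invCDF S (p 0 ω) ∂P < x) (hcdf : ∀ᶠ K in atTop, cdf (S' K) x ≤ αe) :
    Tendsto (fun K : ℕ => power P S (S' K) p αe K) atTop (𝓝 1) := by
  have hT := tendstoInMeasure_ensembleStat hindep hp hint
  rw [tendstoInMeasure_iff_measureReal_norm] at hT
  have h0 : Tendsto (fun K : ℕ => typeIIError P S (S' K) p αe K) atTop (𝓝 0) := by
    refine tendsto_of_tendsto_of_tendsto_of_le_of_le' tendsto_const_nhds (hT _ (sub_pos.2 hx))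
      (Eventually.of_forall fun K => measureReal_nonneg) ?_
    filter_upwards [hcdf] with K hK
    refine measureReal_mono fun ω hω => ?_
    have h1 : x < ensembleStat S (fun k : Fin K => p k ω) :=
      (monotone_cdf (S' K)).reflect_lt (hK.trans_lt hω)
    exact (sub_le_sub_right h1.le _).trans (le_abs_self _)
  simpa [power] using h0.const_sub 1

end Consistency

end ECIT

theorem theorem2 {Ω : Type*} [MeasurableSpace Ω] (P : Measure Ω) [IsProbabilityMeasure P]
    (α γ : ℝ) (hα : 1 ≤ α)
    -- the laws `S(α, 0, γ, 0)` and, for each `K`, `S(α, 0, γ', 0)` with `γ' = K ^ (1/α - 1) γ`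
    (S : Measure ℝ) (hS : ECIT.IsStableLaw S α 0 γ 0)
    (S' : ℕ → Measure ℝ)
    (hS' : ∀ K : ℕ, 1 ≤ K → ECIT.IsStableLaw (S' K) α 0 (ECIT.ensembleScale α γ K) 0)
    -- i.i.d. p-values of the subtests under the alternative, with density `f₁`
    (p : ℕ → Ω → ℝ) (f₁ : ℝ → ℝ)
    (hindep : iIndepFun p P)
    (hf₁ : ∀ k, ECIT.HasPValueDensity P (p k) f₁)
    (hint : ∀ k, Integrable (fun ω => ECIT.invCDF S (p k ω)) P)
    -- the level; `hhalf` is automatic when `αe < 1/2`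
    (αe : ℝ) (hαe : αe ∈ Set.Ioo (0 : ℝ) 1)
    (hmean : ∀ k, ∫ ω, p k ω ∂P ≤ αe)
    (hhalf : ∀ k, ∫ ω, p k ω ∂P < 1 / 2)
    (hsymm : ∀ t ∈ Set.Icc (0 : ℝ) (1 / 2), f₁ (1 - t) ≤ f₁ t) :
    Tendsto (fun K : ℕ => ECIT.power P S (S' K) p αe K) atTop (𝓝 1) := by
  have hcdf : ∀ K : ℕ, 1 ≤ K → ∀ x, cdf (S' K) x = cdf S (x / (K : ℝ) ^ (1 / α - 1)) :=
    fun K hK => hS.cdf_eq_cdf_div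
      (Real.rpow_pos_of_pos (by exact_mod_cast hK) _) (hS' K hK)
  rcases hα.eq_or_lt with rfl | hα1
  · -- all null laws agree with `S`, so `x` is taken where `cdf S x` is still at most `αe`
    have hlt := (ECIT.cdf_integral_invCDF_lt hS (hf₁ 0) (hhalf 0) hsymm (hint 0)).trans_le (hmean 0)
    have hright := ((cdf S).right_continuous (∫ ω, ECIT.invCDF S (p 0 ω) ∂P)).mono_left
      (nhdsWithin_mono _ Set.Ioi_subset_Ici_self)
    obtain ⟨x, hx, hxm⟩ := ((hright.eventually (gt_mem_nhds hlt)).and self_mem_nhdsWithin).exists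
    refine ECIT.tendsto_power_of_integral_lt hindep hf₁ hint hxm ?_
    filter_upwards [eventually_ge_atTop 1] with K hK
    rw [hcdf K hK]
    simpa using hx.le
  · -- the null laws concentrate at `0`, so any `x` between the mean and `0` will do
    obtain ⟨x, hxm, hx0⟩ :=
      exists_between (ECIT.integral_invCDF_neg hS (hf₁ 0) (hhalf 0) hsymm (hint 0))
    refine ECIT.tendsto_power_of_integral_lt hindep hf₁ hint hxm ?_
    have hexp : 0 < 1 - 1 / α := sub_pos.2 ((div_lt_one (by linarith)).2 hα1)
    have hlim : Tendsto (fun K : ℕ => x / (K : ℝ) ^ (1 / α - 1)) atTop atBot := by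
      have h1 : Tendsto (fun K : ℕ => x * (K : ℝ) ^ (1 - 1 / α)) atTop atBot :=
        ((tendsto_rpow_atTop hexp).comp tendsto_natCast_atTop_atTop).const_mul_atTop_of_neg hx0
      refine h1.congr fun K => ?_
      rw [← neg_sub (1 / α) 1, Real.rpow_neg (Nat.cast_nonneg K), div_eq_mul_inv x]
    filter_upwards [eventually_ge_atTop 1,
      ((tendsto_cdf_atBot S).comp hlim).eventually (gt_mem_nhds hαe.1)] with K hK h
    rw [hcdf K hK]
    exact h.le
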